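/- Let $1\le d$, let $M\subseteq\mathbb{R}^m$ be an embedded $d$-dimensional $C^2$ submanifold with the Riemannian metric induced from $\mathbb{R}^m$, let $\nu$ be its Riemannian volume measure, and let $p\in M$. Let $X$ be a random vector in $\mathbb{R}^m$ that near $p$ takes values in $M$ and has density $g\ge 0$ with respect to $\nu$; that is, for some $\rho>0$, $\mathbb{P}(X\in A)=\int_{A\cap M} g\,d\nu$ for every Borel set $A\subseteq B_\rho(p)$. Assume that the restriction of $g$ to $M$ is Lipschitz on a neighbourhood of $p$ in $M$ and that $g(p)>0$. Write $B_r(p)$ for the open Euclidean ball in $\mathbb{R}^m$ and $T_pM\subseteq\mathbb{R}^m$ for the tangent space as a linear subspace, and let $\pi(x)$ be the orthogonal projection of $x-p$ onto $T_pM$. For small $r>0$ let $X(r)$ be a random vector with density $g_r=g\,\mathbf 1_{M\cap B_r(p)}\big/\int_{M\cap B_r(p)}g\,d\nu$ with respect to $\nu$, let $W(r)=\pi(X(r))$, and let $\widehat W(r)=W(r)/\|W(r)\|$ (which is defined almost surely). Let $D(r)$ be uniformly distributed on the open $r$-ball of $T_pM$ around the origin, and let $Z$ be uniformly distributed on the unit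 sphere $S^{d-1}$ of $T_pM$. Then there are constants $C>0$ and $r_0>0$ such that for every $0<r<r_0$ there is a coupling $(W(r),D(r))$ of the laws of $W(r)$ and $D(r)$ with $$\mathbb{P}\{W(r)\ne D(r)\}\le C\,r,$$ and such that the pair obtained from it by normalizing both components is a coupling $(\widehat W(r),Z)$ of the law of $\widehat W(r)$ with the uniform distribution on $S^{d-1}$, with $$\mathbb{P}\{\widehat W(r)\ne Z\}\le C\,r.$$ -/

import Mathlib

open MeasureTheory ProbabilityTheory Topology Filter
open scoped NNReal ENNReal

noncomputable section

/-- `φ : U → M` is a local `C²` parametrization of `M ⊆ ℝᵐ`: an immersion on the open set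
`U ⊆ ℝᵈ` of class `C²` that is a homeomorphism of `U` onto a relatively open subset of `M`. -/
structure IsLocalParam {m d : ℕ} (M : Set (EuclideanSpace ℝ (Fin m)))
    (U : Set (EuclideanSpace ℝ (Fin d)))
    (φ : EuclideanSpace ℝ (Fin d) → EuclideanSpace ℝ (Fin m)) : Prop where
  isOpen_source : IsOpen U
  contDiffOn : ContDiffOn ℝ 2 φ U
  immersion : ∀ u ∈ U, Function.Injective (fderiv ℝ φ u)
  isEmbedding : IsEmbedding (U.domRestrict φ)
  image_relOpen : ∃ V : Set (EuclideanSpace ℝ (Fin m)), IsOpen V ∧ φ '' U = M ∩ V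

/-- `M` is an (embedded) `d`-dimensional `C²` submanifold of `ℝᵐ`. -/
def IsC2Submanifold {m : ℕ} (d : ℕ) (M : Set (EuclideanSpace ℝ (Fin m))) : Prop :=
  ∀ x ∈ M, ∃ (U : Set (EuclideanSpace ℝ (Fin d)))
    (φ : EuclideanSpace ℝ (Fin d) → EuclideanSpace ℝ (Fin m)),
    IsLocalParam M U φ ∧ x ∈ φ '' U

/-- The density `√ det (⟨∂ᵢφ, ∂ⱼφ⟩)ᵢⱼ` of the Riemannian volume form in the coordinates `φ`. -/
def gramDensity {m d : ℕ} (φ : EuclideanSpace ℝ (Fin d) → EuclideanSpace ℝ (Fin m))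
    (u : EuclideanSpace ℝ (Fin d)) : ℝ :=
  Real.sqrt (Matrix.gram ℝ fun i : Fin d => fderiv ℝ φ u (EuclideanSpace.single i (1 : ℝ))).det

/-- The Riemannian volume computed in a single parametrization `φ : U → M`:
`A ↦ ∫_{U ∩ φ⁻¹ A} √ det (⟨∂ᵢφ, ∂ⱼφ⟩) dx`. -/
def chartVolume {m d : ℕ} (U : Set (EuclideanSpace ℝ (Fin d)))
    (φ : EuclideanSpace ℝ (Fin d) → EuclideanSpace ℝ (Fin m)) :
    Measure (EuclideanSpace ℝ (Fin m)) :=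
  ((volume.restrict U).withDensity fun u => ENNReal.ofReal (gramDensity φ u)).map φ

/-- The Riemannian volume measure of a `d`-dimensional `C²` submanifold `M` of `ℝᵐ`, as a measure
on `ℝᵐ` carried by `M`. The measures `chartVolume U φ` agree on overlaps of parametrized patches
(change of variables), and countably many patches cover `M`; hence their least upper bound is the
measure that is given on every parametrized patch by the coordinate formula. -/
def riemannianVolume {m : ℕ} (d : ℕ) (M : Set (EuclideanSpace ℝ (Fin m))) :
    Measure (EuclideanSpace ℝ (Fin m)) :=
  ⨆ (U : Set (EuclideanSpace ℝ (Fin d)))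
    (φ : EuclideanSpace ℝ (Fin d) → EuclideanSpace ℝ (Fin m))
    (_ : IsLocalParam M U φ), chartVolume U φ

/-- The (embedded) tangent space to `M` at `p`: the velocities at `p` of curves in `M`.
For a submanifold these velocities already form a linear subspace; the span only serves to
make the definition one of a subspace for every set `M`. -/
def embTangentSpace {m : ℕ} (M : Set (EuclideanSpace ℝ (Fin m)))
    (p : EuclideanSpace ℝ (Fin m)) : Submodule ℝ (EuclideanSpace ℝ (Fin m)) :=
  Submodule.span ℝ {v | ∃ c : ℝ → EuclideanSpace ℝ (Fin m),
    c 0 = p ∧ (∀ᶠ t in 𝓝 (0 : ℝ), c t ∈ M) ∧ HasDerivAt c v 0}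

/-- Orthogonal projection onto the tangent space at `p`, with `p` taken as the origin. -/
def tangentProj {m : ℕ} (M : Set (EuclideanSpace ℝ (Fin m))) (p : EuclideanSpace ℝ (Fin m))
    (x : EuclideanSpace ℝ (Fin m)) : embTangentSpace M p :=
  (embTangentSpace M p).orthogonalProjectionOnto (x - p)

/-- Near `p`, the random vector `X` lives on `M` and has the density `g` with respect to the
Riemannian volume measure of `M`. Only the values of `g` on `M` near `p` matter. -/
def HasDensityNear {m : ℕ} (d : ℕ) (M : Set (EuclideanSpace ℝ (Fin m)))
    (p : EuclideanSpace ℝ (Fin m)) {Ω : Type*} [MeasurableSpace Ω] (P : Measure Ω)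
    (X : Ω → EuclideanSpace ℝ (Fin m)) (g : EuclideanSpace ℝ (Fin m) → ℝ) : Prop :=
  ∃ ρ > 0, (∀ x ∈ M ∩ Metric.ball p ρ, 0 ≤ g x) ∧
    AEMeasurable g ((riemannianVolume d M).restrict (Metric.ball p ρ)) ∧
    (P.map X).restrict (Metric.ball p ρ) =
      ((riemannianVolume d M).restrict (Metric.ball p ρ)).withDensity
        fun x => ENNReal.ofReal (g x)

open Classical in
/-- The normalized restriction `g_r` of `g` to `M ∩ B_r(p)`. -/
def restrictedDensity {m : ℕ} (d : ℕ) (M : Set (EuclideanSpace ℝ (Fin m)))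
    (p : EuclideanSpace ℝ (Fin m)) (g : EuclideanSpace ℝ (Fin m) → ℝ) (r : ℝ)
    (z : EuclideanSpace ℝ (Fin m)) : ℝ :=
  if z ∈ M ∩ Metric.ball p r then
    g z / ∫ y in M ∩ Metric.ball p r, g y ∂(riemannianVolume d M)
  else 0

/-- The law of `X(r)`: the measure with density `g_r` with respect to the volume of `M`. -/
def lawX {m : ℕ} (d : ℕ) (M : Set (EuclideanSpace ℝ (Fin m)))
    (p : EuclideanSpace ℝ (Fin m)) (g : EuclideanSpace ℝ (Fin m) → ℝ) (r : ℝ) :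
    Measure (EuclideanSpace ℝ (Fin m)) :=
  (riemannianVolume d M).withDensity fun z => ENNReal.ofReal (restrictedDensity d M p g r z)

/-- The law of the projection `W(r)` of `X(r)` to the tangent space at `p`. -/
def lawW {m : ℕ} (d : ℕ) (M : Set (EuclideanSpace ℝ (Fin m)))
    (p : EuclideanSpace ℝ (Fin m)) (g : EuclideanSpace ℝ (Fin m) → ℝ) (r : ℝ) :
    Measure (embTangentSpace M p) :=
  (lawX d M p g r).map (tangentProj M p)

/-- The uniform distribution on the open `r`-ball of `T` around the origin: the law of `D(r)`.
Here `volume` is the Lebesgue measure of the Euclidean space `T`: a cube spanned by an orthonormal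
basis of `T` has measure one. -/
def uniformBall {m : ℕ} (T : Submodule ℝ (EuclideanSpace ℝ (Fin m))) (r : ℝ) : Measure T :=
  ProbabilityTheory.cond (volume : Measure T) (Metric.ball 0 r)

/-- The uniform distribution on the unit sphere of `T` (normalized surface measure), as a measure
on `T`: the law of `Z`. -/
def uniformSphere {m : ℕ} (T : Submodule ℝ (EuclideanSpace ℝ (Fin m))) : Measure T :=
  (ProbabilityTheory.cond (volume : Measure T).toSphere Set.univ).map Subtype.val

/-- The normalization `w ↦ w / ‖w‖`. -/
def unitVec {m : ℕ} {T : Submodule ℝ (EuclideanSpace ℝ (Fin m))} (w : T) : T := ‖w‖⁻¹ • w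

/-- `γ` is a coupling of the distributions `μ` and `ν`: the law of a random pair with first
marginal `μ` and second marginal `ν`. -/
structure IsCoupling {α β : Type*} [MeasurableSpace α] [MeasurableSpace β]
    (γ : Measure (α × β)) (μ : Measure α) (ν : Measure β) : Prop where
  isProb : IsProbabilityMeasure γ
  map_fst : γ.map Prod.fst = μ
  map_snd : γ.map Prod.snd = ν

end

/-! ### Couplings from a common part -/

section Coupling

/-! Near `p` the manifold is a graph `φ` over its tangent space, tangent to it at the origin. The
mean value inequality gives `‖φ u - p‖ ≤ ‖u‖ (1 + c ‖u‖)`, and projecting back does not increase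
distances. So `M ∩ B_r(p)` projects onto a set `A` between the balls of radius `(1 - c r) r` and
`r`. In these coordinates the density of `W(r)` is proportional on `A` to `k = √det(Gram) · (g ∘
φ)`, and `|k u - k₀| ≤ c r` there, with `k₀ = k 0 > 0`.

Hence the law of `W(r)` and the uniform law on the `r`-ball both dominate one constant multiple of
Lebesgue measure on `A`, of mass `1 - O(r)` (`exists_common_part_uniform`). Two laws with a common
part can be coupled to agree outside an event of at most the missing mass
(`exists_isCoupling_of_le`). Normalizing the pair cannot separate equal points, and the direction of
a uniform point of a ball is uniform on the sphere, so the same coupling settles the directions.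

To work in coordinates one must know that the volume, defined as a supremum over all charts, is
given near `p` by the single chart `φ`. This is the change of variables formula
(`IsGraphChart.chartVolume_le`). -/

theorem ENNReal.inv_smul_smul_measure_eq {α : Type*} [MeasurableSpace α] (μ : Measure α)
    {a : ℝ≥0∞} (ha : μ Set.univ = a) (ha' : a ≠ ∞) : a⁻¹ • a • μ = μ := by
  rcases eq_or_ne a 0 with h | h
  · have : μ = 0 := Measure.measure_univ_eq_zero.1 (ha.trans h)
    simp [this]
  · rw [smul_smul, ENNReal.inv_mul_cancel h ha', one_smul]

/-- Two distributions with a common part `κ` have a coupling that is diagonal up to the mass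
missing from `κ`. -/
theorem exists_isCoupling_of_le {α : Type*} [MeasurableSpace α]
    (hdiag : MeasurableSet {z : α × α | z.1 ≠ z.2}) {μ ν κ : Measure α}
    [IsProbabilityMeasure μ] [IsProbabilityMeasure ν] (hμ : κ ≤ μ) (hν : κ ≤ ν) :
    ∃ γ : Measure (α × α), IsCoupling γ μ ν ∧ γ {z | z.1 ≠ z.2} ≤ 1 - κ Set.univ := by
  have : IsFiniteMeasure κ := ⟨(hμ _).trans_lt (measure_lt_top μ _)⟩
  set a : ℝ≥0∞ := 1 - κ Set.univ with ha
  have hμa : (μ - κ) Set.univ = a := by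
    rw [Measure.sub_apply .univ hμ, measure_univ]
  have hνa : (ν - κ) Set.univ = a := by
    rw [Measure.sub_apply .univ hν, measure_univ]
  have hat : a ≠ ∞ := ne_top_of_le_ne_top ENNReal.one_ne_top tsub_le_self
  have : IsFiniteMeasure (μ - κ) := ⟨by rw [hμa]; exact hat.lt_top⟩
  have : IsFiniteMeasure (ν - κ) := ⟨by rw [hνa]; exact hat.lt_top⟩
  have hd : Measurable fun x : α => (x, x) := by fun_prop
  -- The common part sits on the diagonal; the two residues, both of mass `a`, are coupled
  -- independently. If `a = 0` the product vanishes, so the infinite factor `a⁻¹` does no harm.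
  set γ := κ.map (fun x : α => (x, x)) + a⁻¹ • (μ - κ).prod (ν - κ) with hγ
  have h1 : γ.map Prod.fst = μ := by
    rw [hγ, Measure.map_add _ _ measurable_fst, Measure.map_smul, Measure.map_fst_prod, hνa,
      ENNReal.inv_smul_smul_measure_eq _ hμa hat, Measure.map_map measurable_fst hd]
    have : (Prod.fst ∘ fun x : α => (x, x)) = id := rfl
    rw [this, Measure.map_id, add_comm, Measure.sub_add_cancel_of_le hμ]
  have h2 : γ.map Prod.snd = ν := by
    rw [hγ, Measure.map_add _ _ measurable_snd, Measure.map_smul, Measure.map_snd_prod, hμa,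
      ENNReal.inv_smul_smul_measure_eq _ hνa hat, Measure.map_map measurable_snd hd]
    have : (Prod.snd ∘ fun x : α => (x, x)) = id := rfl
    rw [this, Measure.map_id, add_comm, Measure.sub_add_cancel_of_le hν]
  refine ⟨γ, ⟨⟨?_⟩, h1, h2⟩, ?_⟩
  · rw [← Set.preimage_univ (f := (Prod.fst : α × α → α)),
      ← Measure.map_apply measurable_fst .univ, h1, measure_univ]
  · have h0 : (κ.map (fun x : α => (x, x))) {z | z.1 ≠ z.2} = 0 := by
      rw [Measure.map_apply hd hdiag]; simp
    rw [hγ, Measure.add_apply, h0, zero_add, Measure.smul_apply, smul_eq_mul]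
    calc a⁻¹ * (μ - κ).prod (ν - κ) {z | z.1 ≠ z.2}
        ≤ a⁻¹ * (μ - κ).prod (ν - κ) Set.univ := by gcongr; exact Set.subset_univ _
      _ = a⁻¹ * (a * a) := by
          rw [← Set.univ_prod_univ, Measure.prod_prod, hμa, hνa]
      _ ≤ a := by
          rw [← mul_assoc]
          exact mul_le_of_le_one_left' (ENNReal.inv_mul_le_one a)

theorem IsCoupling.map {α β : Type*} [MeasurableSpace α] [MeasurableSpace β]
    {γ : Measure (α × α)} {μ ν : Measure α} (h : IsCoupling γ μ ν) {f : α → β}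
    (hf : Measurable f) : IsCoupling (γ.map (Prod.map f f)) (μ.map f) (ν.map f) := by
  have hff : Measurable (Prod.map f f) := hf.prodMap hf
  have := h.isProb
  refine ⟨Measure.isProbabilityMeasure_map hff.aemeasurable, ?_, ?_⟩
  · rw [Measure.map_map measurable_fst hff, ← h.map_fst, Measure.map_map hf measurable_fst]
    rfl
  · rw [Measure.map_map measurable_snd hff, ← h.map_snd, Measure.map_map hf measurable_snd]
    rfl

theorem map_prodMap_ne_le {α β : Type*} [MeasurableSpace α] [MeasurableSpace β]
    (γ : Measure (α × α)) {f : α → β} (hf : Measurable f)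
    (hdiag : MeasurableSet {z : β × β | z.1 ≠ z.2}) :
    γ.map (Prod.map f f) {z | z.1 ≠ z.2} ≤ γ {z | z.1 ≠ z.2} := by
  rw [Measure.map_apply (hf.prodMap hf) hdiag]
  exact measure_mono fun z hz h => hz (by simp [h])

end Coupling

/-! ### Directions of uniform points of a ball -/

section Sphere

open scoped Pointwise

variable {m : ℕ} {T : Submodule ℝ (EuclideanSpace ℝ (Fin m))}

theorem measurable_unitVec : Measurable (unitVec : T → T) :=
  (measurable_norm.inv).smul measurable_id

theorem measurableSet_ne_prod : MeasurableSet {z : T × T | z.1 ≠ z.2} :=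
  (measurableSet_eq_fun measurable_fst measurable_snd).compl

/-- The direction of a uniform point of a ball is uniform on the sphere. -/
theorem map_unitVec_uniformBall [Nontrivial T] {r : ℝ} (hr : 0 < r) :
    (uniformBall T r).map unitVec = uniformSphere T := by
  have hn : (Module.finrank ℝ T : ℝ≥0∞) ≠ 0 := by
    simpa using (Module.finrank_pos (R := ℝ) (M := T)).ne'
  have hc : (Module.finrank ℝ T : ℝ≥0∞) ≠ ∞ := ENNReal.natCast_ne_top _
  have hrn : ENNReal.ofReal (r ^ Module.finrank ℝ T) ≠ 0 := by
    simpa using pow_pos hr _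
  ext s hs
  have hs' : MeasurableSet ((Subtype.val : Metric.sphere (0 : T) 1 → T) ⁻¹' s) :=
    measurable_subtype_coe hs
  rw [Measure.map_apply measurable_unitVec hs, uniformBall, cond_apply measurableSet_ball,
    uniformSphere, Measure.map_apply measurable_subtype_coe hs, cond_apply .univ,
    Set.univ_inter, Measure.toSphere_apply_univ, Measure.toSphere_apply' _ hs',
    ENNReal.mul_inv (.inl hn) (.inl hc)]
  set S : Set T := Set.Ioo (0 : ℝ) 1 •
    ((Subtype.val : Metric.sphere (0 : T) 1 → T) '' (Subtype.val ⁻¹' s)) with hS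
  -- `toSphere` measures a set on the sphere by the volume of the cone over it. The origin is
  -- removed because `unitVec 0 = 0` is not a direction; it is a null set as `T` is nontrivial.
  have key : (Metric.ball (0 : T) r ∩ unitVec ⁻¹' s) \ {0} = r • S := by
    ext w
    rw [Set.mem_smul_set, hS, Subtype.image_preimage_coe]
    simp only [Set.mem_sdiff, Set.mem_inter_iff, mem_ball_zero_iff, Set.mem_preimage,
      Set.mem_singleton_iff, Set.mem_smul, mem_sphere_zero_iff_norm, Set.mem_Ioo]
    constructor
    · rintro ⟨⟨h1, h2⟩, h3⟩
      have hw : 0 < ‖w‖ := norm_pos_iff.2 h3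
      refine ⟨r⁻¹ • w, ⟨‖w‖ / r, ⟨by positivity, (div_lt_one hr).2 h1⟩, unitVec w,
        ⟨?_, h2⟩, ?_⟩, ?_⟩
      · rw [unitVec, norm_smul, norm_inv, norm_norm, inv_mul_cancel₀ hw.ne']
      · rw [unitVec, smul_smul]; congr 1; field_simp
      · rw [smul_smul, mul_inv_cancel₀ hr.ne', one_smul]
    · rintro ⟨_, ⟨t, ⟨ht0, ht1⟩, v, ⟨hv1, hv⟩, rfl⟩, rfl⟩
      have hnorm : ‖r • t • v‖ = r * t := by
        rw [norm_smul, norm_smul, hv1, Real.norm_of_nonneg hr.le, Real.norm_of_nonneg ht0.le,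
          mul_one]
      have hpos : 0 < r * t := by positivity
      refine ⟨⟨by rw [hnorm]; nlinarith, ?_⟩, ?_⟩
      · rw [unitVec, hnorm, smul_smul, smul_smul, mul_assoc, show (r * t)⁻¹ * (r * t) = 1 from
          inv_mul_cancel₀ hpos.ne', one_smul]
        exact hv
      · intro h; rw [h, norm_zero] at hnorm; linarith
  have h1 : (volume : Measure T) (Metric.ball (0 : T) r ∩ unitVec ⁻¹' s)
      = ENNReal.ofReal (r ^ Module.finrank ℝ T) * volume S := by
    rw [← measure_sdiff_null (measure_singleton (0 : T)), key, Measure.addHaar_smul,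
      abs_of_pos (pow_pos hr _)]
  have h2 : (volume : Measure T) (Metric.ball (0 : T) r)
      = ENNReal.ofReal (r ^ Module.finrank ℝ T) * volume (Metric.ball (0 : T) 1) := by
    simpa using Measure.addHaar_ball_mul (volume : Measure T) 0 hr.le 1
  rw [h1, h2, ENNReal.mul_inv (.inl hrn) (.inl ENNReal.ofReal_ne_top)]
  rw [mul_mul_mul_comm, ENNReal.inv_mul_cancel hrn ENNReal.ofReal_ne_top,
    mul_mul_mul_comm, ENNReal.inv_mul_cancel hn hc]

end Sphere

/-! ### The Gram density -/

section Gram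

variable {m d : ℕ}

theorem measurable_gramDensity (φ : EuclideanSpace ℝ (Fin d) → EuclideanSpace ℝ (Fin m)) :
    Measurable (gramDensity φ) := by
  unfold gramDensity
  simp only [Matrix.det_apply, Matrix.gram_apply]
  refine Measurable.sqrt (Finset.measurable_sum _ fun σ _ => ?_)
  refine Measurable.const_smul (Finset.measurable_prod _ fun i _ => ?_) _
  exact (measurable_fderiv_apply_const ℝ φ _).inner (measurable_fderiv_apply_const ℝ φ _)

theorem contDiffAt_gramDet {φ : EuclideanSpace ℝ (Fin d) → EuclideanSpace ℝ (Fin m)}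
    {u : EuclideanSpace ℝ (Fin d)} (h : ContDiffAt ℝ 2 φ u) :
    ContDiffAt ℝ 1 (fun v => (Matrix.gram ℝ fun i : Fin d =>
      fderiv ℝ φ v (EuclideanSpace.single i (1 : ℝ))).det) u := by
  have hD : ContDiffAt ℝ 1 (fderiv ℝ φ) u := h.fderiv_right (by norm_num)
  simp only [Matrix.det_apply, Matrix.gram_apply]
  refine ContDiffAt.sum fun σ _ => ?_
  refine ContDiffAt.const_smul _ (contDiffAt_prod fun i _ => ?_)
  exact (hD.clm_apply contDiffAt_const).inner ℝ (hD.clm_apply contDiffAt_const)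

theorem gramDet_pos {φ : EuclideanSpace ℝ (Fin d) → EuclideanSpace ℝ (Fin m)}
    {u : EuclideanSpace ℝ (Fin d)} (h : Function.Injective (fderiv ℝ φ u)) :
    0 < (Matrix.gram ℝ fun i : Fin d =>
      fderiv ℝ φ u (EuclideanSpace.single i (1 : ℝ))).det := by
  refine Matrix.PosDef.det_pos (Matrix.posDef_gram_of_linearIndependent ?_)
  have := (EuclideanSpace.basisFun (Fin d) ℝ).toBasis.linearIndependent
  have := this.map' (fderiv ℝ φ u).toLinearMap (LinearMap.ker_eq_bot.2 h)
  have he : (⇑(fderiv ℝ φ u).toLinearMap ∘ ⇑(EuclideanSpace.basisFun (Fin d) ℝ).toBasis) =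
      fun i : Fin d => fderiv ℝ φ u (EuclideanSpace.single i (1 : ℝ)) := by
    ext1 i; simp
  rw [← he]
  exact this

theorem gramDensity_pos {φ : EuclideanSpace ℝ (Fin d) → EuclideanSpace ℝ (Fin m)}
    {u : EuclideanSpace ℝ (Fin d)} (h : Function.Injective (fderiv ℝ φ u)) :
    0 < gramDensity φ u :=
  Real.sqrt_pos.2 (gramDet_pos h)

theorem contDiffAt_gramDensity {φ : EuclideanSpace ℝ (Fin d) → EuclideanSpace ℝ (Fin m)}
    {u : EuclideanSpace ℝ (Fin d)} (h : ContDiffAt ℝ 2 φ u)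
    (hi : Function.Injective (fderiv ℝ φ u)) : ContDiffAt ℝ 1 (gramDensity φ) u :=
  (contDiffAt_gramDet h).sqrt (gramDet_pos hi).ne'

/-- The Gram density is multiplied by the Jacobian under a change of parameters. -/
theorem gramDensity_comp {φ ψ : EuclideanSpace ℝ (Fin d) → EuclideanSpace ℝ (Fin m)}
    {u v : EuclideanSpace ℝ (Fin d)} {D : EuclideanSpace ℝ (Fin d) →L[ℝ] EuclideanSpace ℝ (Fin d)}
    (h : fderiv ℝ ψ u = (fderiv ℝ φ v).comp D) :
    gramDensity ψ u = |D.det| * gramDensity φ v := by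
  have hb : ∀ w : EuclideanSpace ℝ (Fin d), fderiv ℝ φ v w =
      ∑ k, w k • fderiv ℝ φ v (EuclideanSpace.single k (1 : ℝ)) := fun w => by
    conv_lhs => rw [← (EuclideanSpace.basisFun (Fin d) ℝ).sum_repr w]
    simp
  set N : Matrix (Fin d) (Fin d) ℝ :=
    Matrix.of fun i j => D (EuclideanSpace.single j (1 : ℝ)) i with hN
  have hdet : D.det = N.det := by
    rw [ContinuousLinearMap.det,
      ← LinearMap.det_toMatrix (EuclideanSpace.basisFun (Fin d) ℝ).toBasis]
    congr 1
  -- The Gram matrix transforms as a quadratic form, so its determinant acquires the square of the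
  -- Jacobian.
  have hG : (Matrix.gram ℝ fun i : Fin d => fderiv ℝ ψ u (EuclideanSpace.single i (1 : ℝ))) =
      N.transpose * (Matrix.gram ℝ fun i : Fin d =>
        fderiv ℝ φ v (EuclideanSpace.single i (1 : ℝ))) * N := by
    ext i j
    rw [Matrix.gram_apply, h, ContinuousLinearMap.comp_apply, ContinuousLinearMap.comp_apply,
      hb (D _), hb (D (EuclideanSpace.single j 1))]
    simp only [sum_inner, inner_sum, inner_smul_left, inner_smul_right, Matrix.mul_apply,
      Matrix.gram_apply, hN, Matrix.transpose_apply, Matrix.of_apply, Finset.sum_mul,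
      Finset.mul_sum]
    refine Finset.sum_congr rfl fun a _ => Finset.sum_congr rfl fun b _ => ?_
    rw [conj_trivial, real_inner_comm]
    ring
  rw [gramDensity, gramDensity, hG, Matrix.det_mul, Matrix.det_mul, Matrix.det_transpose, hdet,
    mul_right_comm, ← sq, Real.sqrt_mul (sq_nonneg _), Real.sqrt_sq_eq_abs]

end Gram

/-! ### Graph charts over the tangent space -/

section GraphChart

variable {m d : ℕ} {M : Set (EuclideanSpace ℝ (Fin m))} {p : EuclideanSpace ℝ (Fin m)}
  {ι : EuclideanSpace ℝ (Fin d) →ₗᵢ[ℝ] EuclideanSpace ℝ (Fin m)}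

/-- The coordinates of the orthogonal projection of `x - p` to the range of `ι`. -/
noncomputable def graphCoord (ι : EuclideanSpace ℝ (Fin d) →ₗᵢ[ℝ] EuclideanSpace ℝ (Fin m))
    (p x : EuclideanSpace ℝ (Fin m)) : EuclideanSpace ℝ (Fin d) :=
  ContinuousLinearMap.adjoint ι.toContinuousLinearMap (x - p)

theorem LinearIsometry.adjoint_apply_self (v : EuclideanSpace ℝ (Fin d)) :
    ContinuousLinearMap.adjoint ι.toContinuousLinearMap (ι v) = v := by
  refine ext_inner_right ℝ fun w => ?_
  rw [ContinuousLinearMap.adjoint_inner_left]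
  exact ι.inner_map_map v w

theorem graphCoord_self : graphCoord ι p p = 0 := by simp [graphCoord]

theorem norm_graphCoord_le (x : EuclideanSpace ℝ (Fin m)) : ‖graphCoord ι p x‖ ≤ ‖x - p‖ := by
  refine (ContinuousLinearMap.le_opNorm _ _).trans ?_
  rw [LinearIsometryEquiv.norm_map]
  exact mul_le_of_le_one_left (norm_nonneg _) ι.norm_toContinuousLinearMap_le

theorem hasFDerivAt_graphCoord (x : EuclideanSpace ℝ (Fin m)) :
    HasFDerivAt (graphCoord ι p) (ContinuousLinearMap.adjoint ι.toContinuousLinearMap) x := by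
  have h : graphCoord ι p = fun y =>
      ContinuousLinearMap.adjoint ι.toContinuousLinearMap y -
        ContinuousLinearMap.adjoint ι.toContinuousLinearMap p :=
    funext fun y => map_sub _ y p
  rw [h]
  exact (ContinuousLinearMap.hasFDerivAt _).sub_const _

theorem contDiff_graphCoord {n : WithTop ℕ∞} : ContDiff ℝ n (graphCoord ι p) :=
  (ContinuousLinearMap.contDiff _).comp (contDiff_id.sub contDiff_const)

theorem continuous_graphCoord : Continuous (graphCoord ι p) :=
  (contDiff_graphCoord (n := 0)).continuous

/-- `φ : U → M ∩ V` parametrizes the patch `M ∩ V` around `p` as a graph over the tangent space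
at `p`, which is the range of `ι`. -/
structure IsGraphChart (M : Set (EuclideanSpace ℝ (Fin m))) (p : EuclideanSpace ℝ (Fin m))
    (ι : EuclideanSpace ℝ (Fin d) →ₗᵢ[ℝ] EuclideanSpace ℝ (Fin m))
    (U : Set (EuclideanSpace ℝ (Fin d)))
    (φ : EuclideanSpace ℝ (Fin d) → EuclideanSpace ℝ (Fin m))
    (V : Set (EuclideanSpace ℝ (Fin m))) : Prop where
  isLocalParam : IsLocalParam M U φ
  isOpen_target : IsOpen V
  image_eq : φ '' U = M ∩ V
  zero_mem : 0 ∈ U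
  map_zero : φ 0 = p
  graphCoord_map : ∀ u ∈ U, graphCoord ι p (φ u) = u
  hasFDerivAt_zero : HasFDerivAt φ ι.toContinuousLinearMap 0

theorem exists_linearIsometry_range_eq
    {A : EuclideanSpace ℝ (Fin d) →L[ℝ] EuclideanSpace ℝ (Fin m)} (hA : Function.Injective A) :
    ∃ ι : EuclideanSpace ℝ (Fin d) →ₗᵢ[ℝ] EuclideanSpace ℝ (Fin m),
      Set.range ι = Set.range A := by
  have hT : Module.finrank ℝ (LinearMap.range A.toLinearMap) = d := by
    rw [LinearMap.finrank_range_of_inj hA, finrank_euclideanSpace_fin]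
  let e := ((stdOrthonormalBasis ℝ (LinearMap.range A.toLinearMap)).reindex (finCongr hT)).repr
  refine ⟨(LinearMap.range A.toLinearMap).subtypeₗᵢ.comp e.symm.toLinearIsometry, ?_⟩
  have : ⇑((LinearMap.range A.toLinearMap).subtypeₗᵢ.comp e.symm.toLinearIsometry) =
      Subtype.val ∘ e.symm := rfl
  rw [this, Set.range_comp, e.symm.surjective.range_eq, Set.image_univ, Subtype.range_coe]
  rfl

/-- Composing any parametrization with the projection to the range of its derivative gives a map
with invertible derivative at the base point. Reparametrizing by its local inverse `Φ.symm` yields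
the graph. -/
theorem exists_isGraphChart (hM : IsC2Submanifold d M) (hp : p ∈ M) :
    ∃ (ι : EuclideanSpace ℝ (Fin d) →ₗᵢ[ℝ] EuclideanSpace ℝ (Fin m))
      (U : Set (EuclideanSpace ℝ (Fin d)))
      (φ : EuclideanSpace ℝ (Fin d) → EuclideanSpace ℝ (Fin m))
      (V : Set (EuclideanSpace ℝ (Fin m))), IsGraphChart M p ι U φ V := by
  obtain ⟨U, φ, hφ, u₀, hu₀, hpu⟩ := hM p hp
  obtain ⟨ι, hι⟩ := exists_linearIsometry_range_eq (hφ.immersion u₀ hu₀)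
  set A := fderiv ℝ φ u₀ with hA
  set B : EuclideanSpace ℝ (Fin d) →L[ℝ] EuclideanSpace ℝ (Fin d) :=
    (ContinuousLinearMap.adjoint ι.toContinuousLinearMap).comp A with hB
  have hBinj : Function.Injective B := by
    intro v w hvw
    obtain ⟨v', hv'⟩ : A v ∈ Set.range ι := hι ▸ ⟨v, rfl⟩
    obtain ⟨w', hw'⟩ : A w ∈ Set.range ι := hι ▸ ⟨w, rfl⟩
    rw [hB, ContinuousLinearMap.comp_apply, ContinuousLinearMap.comp_apply, ← hv', ← hw',
      LinearIsometry.adjoint_apply_self, LinearIsometry.adjoint_apply_self] at hvw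
    exact hφ.immersion u₀ hu₀ (by rw [← hA, ← hv', ← hw', hvw])
  let B' : EuclideanSpace ℝ (Fin d) ≃L[ℝ] EuclideanSpace ℝ (Fin d) :=
    (LinearEquiv.ofInjectiveEndo B.toLinearMap hBinj).toContinuousLinearEquiv
  have hB' : (B' : EuclideanSpace ℝ (Fin d) →L[ℝ] EuclideanSpace ℝ (Fin d)) = B := by
    ext1 v; rfl
  have hφu : ∀ u ∈ U, ContDiffAt ℝ 2 φ u := fun u hu =>
    hφ.contDiffOn.contDiffAt (hφ.isOpen_source.mem_nhds hu)
  have hf : ContDiffAt ℝ 2 (graphCoord ι p ∘ φ) u₀ :=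
    contDiff_graphCoord.contDiffAt.comp u₀ (hφu u₀ hu₀)
  have hf' : HasFDerivAt (graphCoord ι p ∘ φ)
      (B' : EuclideanSpace ℝ (Fin d) →L[ℝ] EuclideanSpace ℝ (Fin d)) u₀ := by
    rw [hB']
    exact (hasFDerivAt_graphCoord _).comp u₀
      ((hφu u₀ hu₀).differentiableAt (by norm_num)).hasFDerivAt
  let Φ := hf.toOpenPartialHomeomorph (graphCoord ι p ∘ φ) hf' (by norm_num)
  have hΦ : ⇑Φ = graphCoord ι p ∘ φ := hf.toOpenPartialHomeomorph_coe hf' (by norm_num)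
  have hsrc : u₀ ∈ Φ.source := hf.mem_toOpenPartialHomeomorph_source hf' (by norm_num)
  have hΦu : Φ u₀ = 0 := by rw [hΦ, Function.comp_apply, hpu, graphCoord_self]
  have hsymm0 : Φ.symm 0 = u₀ := by rw [← hΦu, Φ.left_inv hsrc]
  have htgt : (0 : EuclideanSpace ℝ (Fin d)) ∈ Φ.target := hΦu ▸ Φ.map_source hsrc
  have hsm : ContDiffAt ℝ 2 Φ.symm 0 := by
    have := hf.to_localInverse hf' (by norm_num)
    rwa [Function.comp_apply, hpu, graphCoord_self] at this
  -- The inverse function theorem gives `C²` regularity at `0`; it persists on a neighbourhood, to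
  -- which the chart is shrunk.
  obtain ⟨W, hW, hWo, h0W⟩ := eventually_nhds_iff.1 (hsm.eventually (by simp))
  set U₀ : Set (EuclideanSpace ℝ (Fin d)) := (Φ.target ∩ Φ.symm ⁻¹' U) ∩ W with hU₀
  have hU₀o : IsOpen U₀ := (Φ.isOpen_inter_preimage_symm hφ.isOpen_source).inter hWo
  have h0 : (0 : EuclideanSpace ℝ (Fin d)) ∈ U₀ :=
    ⟨⟨htgt, by rw [Set.mem_preimage, hsymm0]; exact hu₀⟩, h0W⟩
  have hcd : ∀ u ∈ U₀, ContDiffAt ℝ 2 (φ ∘ Φ.symm) u := fun u hu =>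
    (hφu _ hu.1.2).comp u (hW u hu.2)
  have hinv : ∀ u ∈ U₀, graphCoord ι p ((φ ∘ Φ.symm) u) = u := fun u hu => by
    have := Φ.right_inv hu.1.1
    rwa [hΦ] at this
  -- Differentiating "projection after chart is the identity" gives a left inverse of the
  -- derivative, hence the immersion property.
  have hder : ∀ u ∈ U₀, (ContinuousLinearMap.adjoint ι.toContinuousLinearMap).comp
      (fderiv ℝ (φ ∘ Φ.symm) u) = ContinuousLinearMap.id ℝ _ := fun u hu => by
    have h1 := (hasFDerivAt_graphCoord (ι := ι) (p := p) _).comp u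
      ((hcd u hu).differentiableAt (by norm_num)).hasFDerivAt
    refine h1.unique ((hasFDerivAt_id u).congr_of_eventuallyEq ?_)
    filter_upwards [hU₀o.mem_nhds hu] with v hv using hinv v hv
  have hpe : (φ ∘ Φ.symm) 0 = p := by rw [Function.comp_apply, hsymm0, hpu]
  obtain ⟨V, hVo, hV⟩ := hφ.image_relOpen
  have hO : IsOpen (Φ.symm '' U₀) :=
    Φ.symm.isOpen_image_of_subset_source hU₀o fun u hu => hu.1.1
  obtain ⟨V₁, hV₁o, hV₁⟩ := hφ.isEmbedding.isInducing.isOpen_iff.1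
    (hO.preimage (continuous_subtype_val : Continuous (Subtype.val : U → _)))
  have himage : (φ ∘ Φ.symm) '' U₀ = M ∩ (V ∩ V₁) := by
    rw [Set.image_comp, ← Set.inter_assoc, ← hV]
    ext x
    constructor
    · rintro ⟨_, ⟨u, hu, rfl⟩, rfl⟩
      have hu' : Φ.symm u ∈ U := hu.1.2
      refine ⟨⟨_, hu', rfl⟩, ?_⟩
      have : (⟨Φ.symm u, hu'⟩ : U) ∈ (Subtype.val ⁻¹' (Φ.symm '' U₀) : Set U) := ⟨u, hu, rfl⟩
      rw [← hV₁] at this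
      exact this
    · rintro ⟨⟨u, hu, rfl⟩, hx⟩
      have : (⟨u, hu⟩ : U) ∈ (U.domRestrict φ ⁻¹' V₁ : Set U) := hx
      rw [hV₁] at this
      exact ⟨u, this, rfl⟩
  refine ⟨ι, U₀, φ ∘ Φ.symm, V ∩ V₁, ⟨hU₀o, fun u hu => (hcd u hu).contDiffWithinAt, ?_, ?_,
    ⟨_, hVo.inter hV₁o, himage⟩⟩, hVo.inter hV₁o, himage, h0, hpe, hinv, ?_⟩
  · intro u hu v w hvw
    have := congrArg (ContinuousLinearMap.adjoint ι.toContinuousLinearMap) hvw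
    rwa [← ContinuousLinearMap.comp_apply, ← ContinuousLinearMap.comp_apply, hder u hu] at this
  · refine IsEmbedding.of_comp (g := graphCoord ι p) ?_ continuous_graphCoord ?_
    · exact ContinuousOn.domRestrict fun u hu => (hcd u hu).continuousAt.continuousWithinAt
    · have : graphCoord ι p ∘ U₀.domRestrict (φ ∘ Φ.symm) = Subtype.val :=
        funext fun u => hinv u u.2
      rw [this]
      exact IsEmbedding.subtypeVal
  -- The derivative at `0` takes values in the range of `ι`, and the adjoint of `ι`, which inverts
  -- `ι` there, sends it to the identity. So it is `ι`.
  · have hd0 : fderiv ℝ (φ ∘ Φ.symm) 0 = ι.toContinuousLinearMap := by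
      have hc : fderiv ℝ (φ ∘ Φ.symm) 0 = A.comp (fderiv ℝ Φ.symm 0) := by
        rw [hA, ← hsymm0]
        refine fderiv_comp 0 ?_ (hsm.differentiableAt (by norm_num))
        rw [hsymm0]
        exact (hφu u₀ hu₀).differentiableAt (by norm_num)
      ext1 v
      obtain ⟨w, hw⟩ : A (fderiv ℝ Φ.symm 0 v) ∈ Set.range ι := hι ▸ ⟨_, rfl⟩
      have h2 : ContinuousLinearMap.adjoint ι.toContinuousLinearMap
          (fderiv ℝ (φ ∘ Φ.symm) 0 v) = v := by
        rw [← ContinuousLinearMap.comp_apply, hder 0 h0]; rfl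
      have h3 : fderiv ℝ (φ ∘ Φ.symm) 0 v = ι w := by rw [hc, hw]; rfl
      rw [h3, LinearIsometry.adjoint_apply_self] at h2
      rw [h3, h2]; rfl
    rw [← hd0]
    exact ((hcd 0 h0).differentiableAt (by norm_num)).hasFDerivAt

namespace IsGraphChart

variable {U : Set (EuclideanSpace ℝ (Fin d))}
  {φ : EuclideanSpace ℝ (Fin d) → EuclideanSpace ℝ (Fin m)} {V : Set (EuclideanSpace ℝ (Fin m))}

theorem map_graphCoord (h : IsGraphChart M p ι U φ V) {x : EuclideanSpace ℝ (Fin m)}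
    (hx : x ∈ M ∩ V) : graphCoord ι p x ∈ U ∧ φ (graphCoord ι p x) = x := by
  rw [← h.image_eq] at hx
  obtain ⟨u, hu, rfl⟩ := hx
  rw [h.graphCoord_map u hu]
  exact ⟨hu, rfl⟩

theorem mem_target (h : IsGraphChart M p ι U φ V) {u : EuclideanSpace ℝ (Fin d)} (hu : u ∈ U) :
    φ u ∈ M ∩ V := h.image_eq ▸ Set.mem_image_of_mem φ hu

theorem contDiffAt (h : IsGraphChart M p ι U φ V) {u : EuclideanSpace ℝ (Fin d)} (hu : u ∈ U) :
    ContDiffAt ℝ 2 φ u :=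
  h.isLocalParam.contDiffOn.contDiffAt (h.isLocalParam.isOpen_source.mem_nhds hu)

theorem base_mem (h : IsGraphChart M p ι U φ V) : p ∈ M ∩ V := h.map_zero ▸ h.mem_target h.zero_mem

/-- A curve in `M` through `p` equals `φ` of its own projection near time `0`, so the chain rule
puts its velocity in the range of `ι`. Conversely, images under `φ` of lines realize every vector of
that range. -/
theorem embTangentSpace_eq (h : IsGraphChart M p ι U φ V) :
    embTangentSpace M p = ι.range := by
  refine le_antisymm (Submodule.span_le.2 ?_) ?_
  · rintro v ⟨c, hc0, hcM, hc⟩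
    have hcV : ∀ᶠ t in 𝓝 (0 : ℝ), c t ∈ V :=
      hc.continuousAt.eventually_mem (h.isOpen_target.mem_nhds (hc0 ▸ h.base_mem.2))
    have h1 : HasDerivAt (graphCoord ι p ∘ c)
        (ContinuousLinearMap.adjoint ι.toContinuousLinearMap v) 0 :=
      (hasFDerivAt_graphCoord _).comp_hasDerivAt 0 hc
    have h2 : HasDerivAt (φ ∘ (graphCoord ι p ∘ c))
        (ι.toContinuousLinearMap (ContinuousLinearMap.adjoint ι.toContinuousLinearMap v)) 0 := by
      refine HasFDerivAt.comp_hasDerivAt 0 ?_ h1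
      rw [Function.comp_apply, hc0, graphCoord_self]
      exact h.hasFDerivAt_zero
    have h3 := h2.congr_of_eventuallyEq (f₁ := c) (by
      filter_upwards [hcM, hcV] with t ht ht'
      exact (h.map_graphCoord ⟨ht, ht'⟩).2.symm)
    rw [hc.unique h3]
    exact ⟨_, rfl⟩
  · rintro _ ⟨w, rfl⟩
    refine Submodule.subset_span ⟨fun t => φ (t • w), ?_, ?_, ?_⟩
    · simp [h.map_zero]
    · have hcont : ContinuousAt (fun t : ℝ => t • w) 0 := by fun_prop
      have := hcont.eventually_mem (s := U)
        (h.isLocalParam.isOpen_source.mem_nhds (by simpa using h.zero_mem))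
      filter_upwards [this] with t ht using (h.mem_target ht).1
    · have h1 : HasDerivAt (fun t : ℝ => t • w) w 0 := by
        simpa using (hasDerivAt_id (0 : ℝ)).smul_const w
      have h2 : HasFDerivAt φ ι.toContinuousLinearMap ((0 : ℝ) • w) := by
        rw [zero_smul]; exact h.hasFDerivAt_zero
      exact h2.comp_hasDerivAt 0 h1

end IsGraphChart

end GraphChart

/-! ### Riemannian volume in one chart -/

section Volume

variable {m d : ℕ} {M : Set (EuclideanSpace ℝ (Fin m))} {p : EuclideanSpace ℝ (Fin m)}
  {ι : EuclideanSpace ℝ (Fin d) →ₗᵢ[ℝ] EuclideanSpace ℝ (Fin m)}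
  {U : Set (EuclideanSpace ℝ (Fin d))}
  {φ : EuclideanSpace ℝ (Fin d) → EuclideanSpace ℝ (Fin m)} {V : Set (EuclideanSpace ℝ (Fin m))}

namespace IsLocalParam

theorem continuousOn (h : IsLocalParam M U φ) : ContinuousOn φ U := h.contDiffOn.continuousOn

theorem injOn (h : IsLocalParam M U φ) : Set.InjOn φ U :=
  Set.injOn_iff_injective.2 h.isEmbedding.injective

theorem contDiffAt (h : IsLocalParam M U φ) {u : EuclideanSpace ℝ (Fin d)} (hu : u ∈ U) :
    ContDiffAt ℝ 2 φ u :=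
  h.contDiffOn.contDiffAt (h.isOpen_source.mem_nhds hu)

theorem map_mem (h : IsLocalParam M U φ) {u : EuclideanSpace ℝ (Fin d)} (hu : u ∈ U) :
    φ u ∈ M := by
  obtain ⟨V, -, hV⟩ := h.image_relOpen
  exact (hV.subset (Set.mem_image_of_mem φ hu)).1

theorem measurableSet_inter_preimage (h : IsLocalParam M U φ)
    {B : Set (EuclideanSpace ℝ (Fin m))} (hB : MeasurableSet B) :
    MeasurableSet (U ∩ φ ⁻¹' B) := by
  have := h.isOpen_source.measurableSet.subtype_image
    (h.continuousOn.domRestrict.measurable hB)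
  convert this using 1
  ext u
  simp [and_comm]

theorem aemeasurable (h : IsLocalParam M U φ) :
    AEMeasurable φ ((volume.restrict U).withDensity fun u => ENNReal.ofReal (gramDensity φ u)) :=
  (h.continuousOn.aemeasurable h.isOpen_source.measurableSet).mono_ac
    (withDensity_absolutelyContinuous _ _)

theorem chartVolume_restrict (h : IsLocalParam M U φ)
    {B : Set (EuclideanSpace ℝ (Fin m))} (hB : MeasurableSet B) :
    (chartVolume U φ).restrict B = chartVolume (U ∩ φ ⁻¹' B) φ := by
  rw [chartVolume, chartVolume, Measure.restrict_map_of_aemeasurable h.aemeasurable hB,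
    restrict_withDensity', Measure.restrict_restrict' h.isOpen_source.measurableSet, Set.inter_comm]

theorem chartVolume_apply (h : IsLocalParam M U φ)
    {B : Set (EuclideanSpace ℝ (Fin m))} (hB : MeasurableSet B) :
    chartVolume U φ B = ∫⁻ u in U ∩ φ ⁻¹' B, ENNReal.ofReal (gramDensity φ u) := by
  rw [chartVolume, Measure.map_apply_of_aemeasurable h.aemeasurable hB,
    withDensity_apply', Measure.restrict_restrict' h.isOpen_source.measurableSet, Set.inter_comm]

end IsLocalParam

namespace IsGraphChart

theorem measurableSet_inter_target (h : IsGraphChart M p ι U φ V) : MeasurableSet (M ∩ V) := by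
  rw [← h.image_eq]
  exact h.isLocalParam.isOpen_source.measurableSet.image_of_continuousOn_injOn
    h.isLocalParam.continuousOn h.isLocalParam.injOn

/-- Comparison of the volumes in two charts, by the change of variables formula. -/
theorem chartVolume_le (h : IsGraphChart M p ι U φ V) {U' : Set (EuclideanSpace ℝ (Fin d))}
    {φ' : EuclideanSpace ℝ (Fin d) → EuclideanSpace ℝ (Fin m)} (h' : IsLocalParam M U' φ')
    {B : Set (EuclideanSpace ℝ (Fin m))} (hB : MeasurableSet B) (hBV : B ⊆ V) :
    chartVolume U' φ' B ≤ chartVolume U φ B := by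
  rw [h'.chartVolume_apply hB, h.isLocalParam.chartVolume_apply hB]
  set s := U' ∩ φ' ⁻¹' B with hs
  set τ := graphCoord ι p ∘ φ' with hτ
  have hmem : ∀ u ∈ s, φ' u ∈ M ∩ V := fun u hu => ⟨h'.map_mem hu.1, hBV hu.2⟩
  have hτd : ∀ u ∈ s, DifferentiableAt ℝ τ u := fun u hu =>
    (hasFDerivAt_graphCoord _).differentiableAt.comp u
      ((h'.contDiffAt hu.1).differentiableAt (by norm_num))
  have hJ : ∀ u ∈ s, gramDensity φ' u = |(fderiv ℝ τ u).det| * gramDensity φ (τ u) := by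
    intro u hu
    refine gramDensity_comp ?_
    -- `τ` is the transition map: `φ'` factors locally through the graph chart.
    have hev : φ' =ᶠ[𝓝 u] φ ∘ τ := by
      have hV := (h'.contDiffAt hu.1).continuousAt.eventually_mem
        (h.isOpen_target.mem_nhds (hmem u hu).2)
      filter_upwards [hV, h'.isOpen_source.mem_nhds hu.1] with v hv hv'
      exact (h.map_graphCoord ⟨h'.map_mem hv', hv⟩).2.symm
    rw [hev.fderiv_eq]
    exact fderiv_comp u ((h.contDiffAt (h.map_graphCoord (hmem u hu)).1).differentiableAt
      (by norm_num)) (hτd u hu)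
  have hinj : Set.InjOn τ s := by
    intro u hu v hv huv
    have := congrArg φ huv
    rw [hτ, Function.comp_apply, Function.comp_apply, (h.map_graphCoord (hmem u hu)).2,
      (h.map_graphCoord (hmem v hv)).2] at this
    exact h'.injOn hu.1 hv.1 this
  have hsm : MeasurableSet s := h'.measurableSet_inter_preimage hB
  calc ∫⁻ u in s, ENNReal.ofReal (gramDensity φ' u)
      = ∫⁻ u in s, ENNReal.ofReal |(fderiv ℝ τ u).det| * ENNReal.ofReal (gramDensity φ (τ u)) := by
        refine setLIntegral_congr_fun hsm fun u hu => ?_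
        rw [← ENNReal.ofReal_mul (abs_nonneg _), ← hJ u hu]
    _ = ∫⁻ u in τ '' s, ENNReal.ofReal (gramDensity φ u) :=
        (lintegral_image_eq_lintegral_abs_det_fderiv_mul volume hsm
          (fun u hu => (hτd u hu).hasFDerivAt.hasFDerivWithinAt) hinj
          fun u => ENNReal.ofReal (gramDensity φ u)).symm
    _ ≤ ∫⁻ u in U ∩ φ ⁻¹' B, ENNReal.ofReal (gramDensity φ u) := by
        refine lintegral_mono_set ?_
        rintro _ ⟨u, hu, rfl⟩
        obtain ⟨h1, h2⟩ := h.map_graphCoord (hmem u hu)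
        exact ⟨h1, by rw [Set.mem_preimage, hτ, Function.comp_apply, h2]; exact hu.2⟩

/-- On the patch of a chart, the Riemannian volume is given by the coordinate formula. -/
theorem riemannianVolume_restrict (h : IsGraphChart M p ι U φ V) :
    (riemannianVolume d M).restrict V = (chartVolume U φ).restrict V := by
  have hVm : MeasurableSet V := h.isOpen_target.measurableSet
  refine le_antisymm ?_ (Measure.restrict_mono_measure ?_ V)
  -- A supremum of measures is bounded by a measure dominating each member on all Borel sets. Off
  -- `V` nothing is known, so `⊤` is used there and disappears on restriction.
  · have hle : riemannianVolume d M ≤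
        (chartVolume U φ).restrict V + (⊤ : Measure _).restrict Vᶜ := by
      refine iSup_le fun U' => iSup_le fun φ' => iSup_le fun h' => ?_
      rw [← Measure.restrict_add_restrict_compl (μ := chartVolume U' φ') hVm]
      refine add_le_add ?_ (Measure.restrict_mono_measure le_top _)
      refine Measure.le_iff.2 fun B hB => ?_
      rw [Measure.restrict_apply hB, Measure.restrict_apply hB]
      exact h.chartVolume_le h' (hB.inter hVm) Set.inter_subset_right
    refine (Measure.restrict_mono_measure hle V).trans (le_of_eq ?_)
    rw [Measure.restrict_add, Measure.restrict_restrict hVm, Measure.restrict_restrict hVm,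
      Set.inter_self, Set.inter_compl_self, Measure.restrict_empty, add_zero]
  · exact le_iSup_of_le U (le_iSup_of_le φ (le_iSup_of_le h.isLocalParam le_rfl))

/-- The coordinates of the points of `M` close to `p`. -/
theorem riemannianVolume_restrict_ball (h : IsGraphChart M p ι U φ V) {r : ℝ}
    (hr : Metric.ball p r ⊆ V) :
    MeasurableSet (M ∩ Metric.ball p r) ∧
      (riemannianVolume d M).restrict (M ∩ Metric.ball p r) =
        chartVolume (U ∩ φ ⁻¹' Metric.ball p r) φ := by
  have hS : M ∩ Metric.ball p r = M ∩ V ∩ Metric.ball p r := by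
    rw [Set.inter_assoc, Set.inter_eq_right.2 hr]
  have hSm : MeasurableSet (M ∩ Metric.ball p r) := by
    rw [hS]; exact h.measurableSet_inter_target.inter measurableSet_ball
  refine ⟨hSm, ?_⟩
  have hSV : (M ∩ Metric.ball p r) ∩ V = M ∩ Metric.ball p r :=
    Set.inter_eq_left.2 (Set.inter_subset_right.trans hr)
  rw [← hSV, ← Measure.restrict_restrict hSm, h.riemannianVolume_restrict,
    Measure.restrict_restrict hSm, hSV, h.isLocalParam.chartVolume_restrict hSm]
  congr 1
  ext u
  simp only [Set.mem_inter_iff, Set.mem_preimage]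
  exact ⟨fun hu => ⟨hu.1, hu.2.2⟩, fun hu => ⟨hu.1, h.isLocalParam.map_mem hu.1, hu.2⟩⟩

end IsGraphChart

end Volume

/-! ### The law of the coordinates -/

section Law

variable {m d : ℕ} {M : Set (EuclideanSpace ℝ (Fin m))} {p : EuclideanSpace ℝ (Fin m)}
  {ι : EuclideanSpace ℝ (Fin d) →ₗᵢ[ℝ] EuclideanSpace ℝ (Fin m)}
  {U : Set (EuclideanSpace ℝ (Fin d))}
  {φ : EuclideanSpace ℝ (Fin d) → EuclideanSpace ℝ (Fin m)} {V : Set (EuclideanSpace ℝ (Fin m))}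

theorem gramDensity_nonneg (φ : EuclideanSpace ℝ (Fin d) → EuclideanSpace ℝ (Fin m))
    (u : EuclideanSpace ℝ (Fin d)) : 0 ≤ gramDensity φ u := Real.sqrt_nonneg _

theorem lawX_congr {g g' : EuclideanSpace ℝ (Fin m) → ℝ} {r : ℝ}
    (hSm : MeasurableSet (M ∩ Metric.ball p r)) (h : Set.EqOn g g' (M ∩ Metric.ball p r)) :
    lawX d M p g r = lawX d M p g' r := by
  unfold lawX
  congr 1
  ext z
  unfold restrictedDensity
  rw [setIntegral_congr_fun hSm h]
  split_ifs with hz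
  · rw [h hz]
  · rfl

/-- The law of the coordinates of `X(r)`. -/
theorem IsGraphChart.map_graphCoord_lawX (h : IsGraphChart M p ι U φ V) {r : ℝ}
    (hr : Metric.ball p r ⊆ V) {g : EuclideanSpace ℝ (Fin m) → ℝ} (hg : Measurable g) :
    (lawX d M p g r).map (graphCoord ι p) =
      (volume.restrict (U ∩ φ ⁻¹' Metric.ball p r)).withDensity fun u =>
        ENNReal.ofReal (gramDensity φ u * g (φ u) /
          ∫ v in U ∩ φ ⁻¹' Metric.ball p r, gramDensity φ v * g (φ v)) := by
  obtain ⟨hSm, hS⟩ := h.riemannianVolume_restrict_ball hr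
  set A := U ∩ φ ⁻¹' Metric.ball p r with hA
  have hAm : MeasurableSet A := h.isLocalParam.measurableSet_inter_preimage measurableSet_ball
  have hJm : Measurable fun u => ENNReal.ofReal (gramDensity φ u) :=
    (measurable_gramDensity φ).ennreal_ofReal
  set κ := (volume.restrict A).withDensity fun u => ENNReal.ofReal (gramDensity φ u) with hκ
  have hφA : AEMeasurable φ (volume.restrict A) :=
    (h.isLocalParam.continuousOn.mono Set.inter_subset_left).aemeasurable hAm
  have hφκ : AEMeasurable φ κ := hφA.mono_ac (withDensity_absolutelyContinuous _ _)
  have hN : ∫ y in M ∩ Metric.ball p r, g y ∂(riemannianVolume d M) =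
      ∫ v in A, gramDensity φ v * g (φ v) := by
    rw [hS, chartVolume, integral_map hφκ hg.aestronglyMeasurable,
      integral_withDensity_eq_integral_toReal_smul hJm (by simp)]
    simp only [ENNReal.toReal_ofReal (gramDensity_nonneg φ _), smul_eq_mul]
  set N := ∫ v in A, gramDensity φ v * g (φ v) with hNdef
  have hlaw : lawX d M p g r =
      (chartVolume A φ).withDensity fun z => ENNReal.ofReal (g z / N) := by
    rw [lawX, ← hS, ← withDensity_indicator hSm]
    congr 1
    ext z
    unfold restrictedDensity
    rw [hN]
    by_cases hz : z ∈ M ∩ Metric.ball p r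
    · rw [if_pos hz, Set.indicator_of_mem hz]
    · rw [if_neg hz, Set.indicator_of_notMem hz, ENNReal.ofReal_zero]
  have hgN : Measurable fun z => ENNReal.ofReal (g z / N) := (hg.div_const N).ennreal_ofReal
  rw [hlaw]
  ext B hB
  have hqB : MeasurableSet (graphCoord ι p ⁻¹' B) :=
    (continuous_graphCoord).measurable hB
  rw [Measure.map_apply continuous_graphCoord.measurable hB, withDensity_apply _ hqB,
    withDensity_apply _ hB, ← lintegral_indicator hqB, chartVolume,
    lintegral_map' (hgN.indicator hqB).aemeasurable hφκ, ← lintegral_indicator hB]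
  refine (lintegral_withDensity_eq_lintegral_mul₀ hJm.aemeasurable
    ((hgN.indicator hqB).comp_aemeasurable hφA)).trans ?_
  refine setLIntegral_congr_fun hAm fun u hu => ?_
  have hqu : graphCoord ι p (φ u) = u := h.graphCoord_map u hu.1
  rw [Pi.mul_apply, Function.comp_apply]
  by_cases hu' : u ∈ B
  · rw [Set.indicator_of_mem (by rwa [Set.mem_preimage, hqu]), Set.indicator_of_mem hu',
      ← ENNReal.ofReal_mul (gramDensity_nonneg φ u), mul_div_assoc]
  · rw [Set.indicator_of_notMem (by rwa [Set.mem_preimage, hqu]), Set.indicator_of_notMem hu',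
      mul_zero]

end Law

/-! ### Comparison with the uniform law -/

section Estimate

variable {d : ℕ} {A : Set (EuclideanSpace ℝ (Fin d))} {k : EuclideanSpace ℝ (Fin d) → ℝ}
  {k₀ c r : ℝ}

/-- For `a, b ≤ 1` one has `1 - a b ≤ (1 - a) + (1 - b)`. The ratio loses at most `2 c r / k₀`, and
the power at most `n c r` by Bernoulli. -/
theorem one_sub_ratio_mul_pow_le (hk₀ : 0 < k₀) (hc : 0 ≤ c * r) (hc1 : c * r < 1)
    (n : ℕ) :
    1 - (k₀ - c * r) / (k₀ + c * r) * (1 - c * r) ^ n ≤ (2 * c / k₀ + n * c) * r := by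
  have ha : (k₀ - c * r) / (k₀ + c * r) ≤ 1 := by
    rw [div_le_one (by linarith)]; linarith
  have ha' : 1 - 2 * (c * r) / k₀ ≤ (k₀ - c * r) / (k₀ + c * r) := by
    rw [le_div_iff₀ (by linarith)]
    have : 2 * (c * r) / k₀ * k₀ = 2 * (c * r) := by field_simp
    nlinarith [div_nonneg (mul_nonneg zero_le_two hc) hk₀.le]
  have hb : (1 - c * r) ^ n ≤ 1 := pow_le_one₀ (by linarith) (by linarith)
  have hb' : 1 + (n : ℝ) * (-(c * r)) ≤ (1 + -(c * r)) ^ n :=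
    one_add_mul_le_pow (by linarith) n
  rw [← sub_eq_add_neg] at hb'
  have e : (2 * c / k₀ + n * c) * r = 2 * (c * r) / k₀ + n * (c * r) := by ring
  rw [e]
  nlinarith [mul_nonneg (sub_nonneg.2 ha) (sub_nonneg.2 hb)]

/-- A density close to a constant on a set that nearly fills a ball is close to the uniform
density on the ball. -/
theorem exists_common_part_uniform (hr : 0 < r) (hk₀ : 0 < k₀) (hc : 0 ≤ c) (hc1 : c * r < 1)
    (hck : c * r < k₀) (hA : MeasurableSet A) (hAB : A ⊆ Metric.ball 0 r)
    (hBA : Metric.ball 0 ((1 - c * r) * r) ⊆ A) (hk : ∀ u ∈ A, |k u - k₀| ≤ c * r)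
    (hkm : AEStronglyMeasurable k (volume.restrict A)) :
    IsProbabilityMeasure ((volume.restrict A).withDensity
      fun u => ENNReal.ofReal (k u / ∫ v in A, k v)) ∧
    ∃ κ : Measure (EuclideanSpace ℝ (Fin d)),
      κ ≤ ((volume.restrict A).withDensity fun u => ENNReal.ofReal (k u / ∫ v in A, k v)) ∧
      κ ≤ cond volume (Metric.ball 0 r) ∧
      1 - κ Set.univ ≤ ENNReal.ofReal ((2 * c / k₀ + d * c) * r) := by
  have hcr : 0 ≤ c * r := mul_nonneg hc hr.le
  have hBt : volume (Metric.ball (0 : EuclideanSpace ℝ (Fin d)) r) ≠ ∞ := measure_ball_lt_top.ne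
  have hAt : volume A ≠ ∞ := ne_top_of_le_ne_top hBt (measure_mono hAB)
  have hA0 : 0 < volume A :=
    (Metric.measure_ball_pos volume 0 (mul_pos (by linarith) hr)).trans_le (measure_mono hBA)
  set v := volume.real (Metric.ball (0 : EuclideanSpace ℝ (Fin d)) r) with hv
  have hv0 : 0 < v := ENNReal.toReal_pos (Metric.measure_ball_pos volume 0 hr).ne' hBt
  have hvA : volume.real A ≤ v := ENNReal.toReal_mono hBt (measure_mono hAB)
  have hvA0 : 0 < volume.real A := ENNReal.toReal_pos hA0.ne' hAt
  have hlo : ∀ u ∈ A, k₀ - c * r ≤ k u := fun u hu => by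
    have := (abs_le.1 (hk u hu)).1; linarith
  have hhi : ∀ u ∈ A, k u ≤ k₀ + c * r := fun u hu => by
    have := (abs_le.1 (hk u hu)).2; linarith
  have hint : IntegrableOn k A := by
    have : IsFiniteMeasure ((volume : Measure (EuclideanSpace ℝ (Fin d))).restrict A) :=
      isFiniteMeasure_restrict.2 hAt
    refine Integrable.of_bound hkm (k₀ + c * r) ?_
    filter_upwards [ae_restrict_mem hA] with u hu
    rw [Real.norm_of_nonneg (by linarith [hlo u hu])]
    exact hhi u hu
  set N := ∫ v in A, k v with hN
  have hNlo : (k₀ - c * r) * volume.real A ≤ N := by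
    have := setIntegral_mono_on (integrableOn_const hAt) hint hA hlo
    rwa [setIntegral_const, smul_eq_mul, mul_comm] at this
  have hNhi : N ≤ (k₀ + c * r) * v := by
    have := setIntegral_mono_on hint (integrableOn_const hAt) hA hhi
    rw [setIntegral_const, smul_eq_mul, mul_comm] at this
    exact this.trans (by gcongr)
  have hN0 : 0 < N := (mul_pos (by linarith) hvA0).trans_le hNlo
  -- The least possible value of `k` over the greatest possible value of its integral: a lower bound
  -- for the normalized density, and also at most `1 / v`.
  set σ := (k₀ - c * r) / ((k₀ + c * r) * v) with hσ
  have hσ0 : 0 ≤ σ := div_nonneg (by linarith) (by positivity)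
  refine ⟨⟨?_⟩, ENNReal.ofReal σ • volume.restrict A, ?_, ?_, ?_⟩
  · rw [withDensity_apply _ .univ, Measure.restrict_univ, ← ofReal_integral_eq_lintegral_ofReal
      (hint.div_const N), integral_div, ← hN, div_self hN0.ne', ENNReal.ofReal_one]
    filter_upwards [ae_restrict_mem hA] with u hu
    exact div_nonneg (by linarith [hlo u hu]) hN0.le
  · rw [← withDensity_const]
    refine withDensity_mono ?_
    filter_upwards [ae_restrict_mem hA] with u hu
    refine ENNReal.ofReal_le_ofReal ?_
    exact div_le_div₀ (by linarith [hlo u hu]) (hlo u hu) hN0 hNhi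
  · have hσv : ENNReal.ofReal σ ≤
        (volume (Metric.ball (0 : EuclideanSpace ℝ (Fin d)) r))⁻¹ := by
      rw [← ENNReal.ofReal_toReal hBt, ← measureReal_def, ← hv, ← ENNReal.ofReal_inv_of_pos hv0]
      refine ENNReal.ofReal_le_ofReal ?_
      rw [hσ, ← one_div, div_le_div_iff₀ (by positivity) hv0]
      nlinarith
    refine Measure.le_iff.2 fun t ht => ?_
    rw [ProbabilityTheory.cond, Measure.smul_apply, Measure.smul_apply, smul_eq_mul, smul_eq_mul]
    exact mul_le_mul' hσv (Measure.restrict_mono_set volume hAB t)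
  -- The mass of the common part is bounded below by that of the inner ball contained in `A`.
  · have hx : ENNReal.ofReal ((k₀ - c * r) / (k₀ + c * r) * (1 - c * r) ^ d) ≤
        (ENNReal.ofReal σ • volume.restrict A) Set.univ := by
      rw [Measure.smul_apply, Measure.restrict_apply_univ, smul_eq_mul]
      calc ENNReal.ofReal ((k₀ - c * r) / (k₀ + c * r) * (1 - c * r) ^ d)
          = ENNReal.ofReal σ * (ENNReal.ofReal ((1 - c * r) ^ d) * ENNReal.ofReal v) := by
            rw [← ENNReal.ofReal_mul (by have : 0 ≤ 1 - c * r := by linarith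
                                         positivity), ← ENNReal.ofReal_mul hσ0]
            congr 1
            rw [hσ]
            field_simp
        _ = ENNReal.ofReal σ * volume (Metric.ball (0 : EuclideanSpace ℝ (Fin d))
              ((1 - c * r) * r)) := by
            rw [Measure.addHaar_ball_mul_of_pos _ _ (by linarith), finrank_euclideanSpace_fin,
              hv, measureReal_def, ENNReal.ofReal_toReal hBt]
        _ ≤ ENNReal.ofReal σ * volume A := by gcongr
    refine (tsub_le_tsub_left hx 1).trans ?_
    rw [← ENNReal.ofReal_one, ← ENNReal.ofReal_sub _ (mul_nonneg
      (div_nonneg (by linarith) (by linarith)) (pow_nonneg (by linarith) _))]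
    exact ENNReal.ofReal_le_ofReal (one_sub_ratio_mul_pow_le hk₀ hcr hc1 d)

end Estimate

/-! ### Flatness of the graph to first order -/

section Graph

variable {m d : ℕ} {M : Set (EuclideanSpace ℝ (Fin m))} {p : EuclideanSpace ℝ (Fin m)}
  {ι : EuclideanSpace ℝ (Fin d) →ₗᵢ[ℝ] EuclideanSpace ℝ (Fin m)}
  {U : Set (EuclideanSpace ℝ (Fin d))}
  {φ : EuclideanSpace ℝ (Fin d) → EuclideanSpace ℝ (Fin m)} {V : Set (EuclideanSpace ℝ (Fin m))}

/-- Since `φ` is `C²`, its derivative is Lipschitz near `0` with value `ι` there. So `φ - ι` varies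
by at most `K ‖u‖²` on the closed ball of radius `‖u‖`, while `ι` preserves norms. -/
theorem IsGraphChart.exists_norm_sub_le (h : IsGraphChart M p ι U φ V) :
    ∃ c : ℝ, 0 ≤ c ∧ ∀ᶠ u in 𝓝 0, ‖φ u - p‖ ≤ ‖u‖ * (1 + c * ‖u‖) := by
  have hD : ContDiffAt ℝ 1 (fderiv ℝ φ) 0 := (h.contDiffAt h.zero_mem).fderiv_right (by norm_num)
  obtain ⟨K, t, ht, hK⟩ := hD.exists_lipschitzOnWith
  have hmem : t ∩ U ∈ 𝓝 (0 : EuclideanSpace ℝ (Fin d)) :=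
    inter_mem ht (h.isLocalParam.isOpen_source.mem_nhds h.zero_mem)
  obtain ⟨ε, hε, hεt⟩ := Metric.mem_nhds_iff.1 hmem
  refine ⟨K, K.2, ?_⟩
  filter_upwards [Metric.ball_mem_nhds 0 hε] with u hu
  have hsub : Metric.closedBall (0 : EuclideanSpace ℝ (Fin d)) ‖u‖ ⊆ t ∩ U := by
    refine (Metric.closedBall_subset_ball ?_).trans hεt
    simpa using hu
  have hbound := (convex_closedBall (0 : EuclideanSpace ℝ (Fin d))
      ‖u‖).norm_image_sub_le_of_norm_hasFDerivWithin_le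
    (f := fun v => φ v - ι.toContinuousLinearMap v)
    (f' := fun v => fderiv ℝ φ v - ι.toContinuousLinearMap) (C := K * ‖u‖) (x := 0) (y := u)
    (fun v hv => (((h.contDiffAt (hsub hv).2).differentiableAt
      (by norm_num)).hasFDerivAt.sub (ContinuousLinearMap.hasFDerivAt _)).hasFDerivWithinAt)
    (fun v hv => by
      have h0 : (0 : EuclideanSpace ℝ (Fin d)) ∈ t := (hsub (by simp)).1
      have := hK.norm_sub_le (hsub hv).1 h0
      rw [h.hasFDerivAt_zero.fderiv, sub_zero] at this
      exact this.trans (mul_le_mul_of_nonneg_left (by simpa using hv) K.2))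
    (by simp) (by simp)
  have e : φ u - p = (φ u - ι.toContinuousLinearMap u -
      (φ 0 - ι.toContinuousLinearMap 0)) + ι u := by
    rw [h.map_zero, _root_.map_zero]
    change _ = φ u - ι u - (p - 0) + ι u
    abel
  rw [e]
  refine (norm_add_le _ _).trans ?_
  rw [ι.norm_map]
  rw [sub_zero] at hbound
  nlinarith

theorem IsGraphChart.exists_abs_density_sub_le (h : IsGraphChart M p ι U φ V)
    {g : EuclideanSpace ℝ (Fin m) → ℝ} {K : ℝ≥0} (hg : LipschitzWith K g) :
    ∃ c : ℝ, 0 ≤ c ∧ ∀ᶠ u in 𝓝 0,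
      |gramDensity φ u * g (φ u) - gramDensity φ 0 * g p| ≤ c * ‖u‖ := by
  have hJd : DifferentiableAt ℝ (gramDensity φ) 0 :=
    (contDiffAt_gramDensity (h.contDiffAt h.zero_mem)
      (h.isLocalParam.immersion 0 h.zero_mem)).differentiableAt (by norm_num)
  have hJ := hJd.isBigO_sub
  have hφ := h.hasFDerivAt_zero.differentiableAt.isBigO_sub
  have hgφ : (fun u => g (φ u) - g (φ 0)) =O[𝓝 0] fun u => u - 0 := by
    refine Asymptotics.IsBigO.trans (Asymptotics.IsBigO.of_bound K (.of_forall fun u => ?_)) hφ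
    exact hg.norm_sub_le _ _
  have hgc : (fun u => g (φ u)) =O[𝓝 0] fun _ => (1 : ℝ) :=
    ((hg.continuous.continuousAt.comp h.hasFDerivAt_zero.continuousAt).isBigO_one ℝ)
  have h1 : (fun u => (gramDensity φ u - gramDensity φ 0) * g (φ u)) =O[𝓝 0]
      fun u => ‖u - 0‖ * (1 : ℝ) := hJ.norm_right.mul hgc
  have h2 : (fun u => gramDensity φ 0 * (g (φ u) - g (φ 0))) =O[𝓝 0]
      fun u => ‖u - 0‖ * (1 : ℝ) := by
    simpa using (hgφ.norm_right.const_mul_left (gramDensity φ 0))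
  obtain ⟨c, hc, hb⟩ := (h1.add h2).exists_nonneg
  refine ⟨c, hc, ?_⟩
  filter_upwards [hb.bound] with u hu
  rw [mul_one, sub_zero, norm_norm, h.map_zero] at hu
  convert hu using 1
  rw [Real.norm_eq_abs]
  congr 1
  ring

/-- In the coordinates of the graph, the law of `X(r)` has a large common part with the uniform
distribution on the ball. -/
theorem IsGraphChart.exists_common_part (h : IsGraphChart M p ι U φ V)
    {g : EuclideanSpace ℝ (Fin m) → ℝ} {K : ℝ≥0} (hg : LipschitzWith K g) (hpos : 0 < g p) :
    ∃ C : ℝ, 0 < C ∧ ∀ᶠ r : ℝ in 𝓝[>] 0,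
      MeasurableSet (M ∩ Metric.ball p r) ∧
      IsProbabilityMeasure ((lawX d M p g r).map (graphCoord ι p)) ∧
      ∃ κ : Measure (EuclideanSpace ℝ (Fin d)),
        κ ≤ (lawX d M p g r).map (graphCoord ι p) ∧
        κ ≤ cond volume (Metric.ball 0 r) ∧ 1 - κ Set.univ ≤ ENNReal.ofReal (C * r) := by
  obtain ⟨c₁, hc₁, h₁⟩ := h.exists_norm_sub_le
  obtain ⟨c₂, hc₂, h₂⟩ := h.exists_abs_density_sub_le hg
  set k₀ := gramDensity φ 0 * g p with hk₀
  have hk₀pos : 0 < k₀ :=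
    mul_pos (gramDensity_pos (h.isLocalParam.immersion 0 h.zero_mem)) hpos
  set c := c₁ + c₂ with hcdef
  have hc : 0 ≤ c := add_nonneg hc₁ hc₂
  obtain ⟨ε₁, hε₁, hb₁⟩ := Metric.eventually_nhds_iff_ball.1
    ((h₁.and h₂).and (h.isLocalParam.isOpen_source.mem_nhds h.zero_mem))
  obtain ⟨ε₂, hε₂, hb₂⟩ := Metric.isOpen_iff.1 h.isOpen_target p h.base_mem.2
  have hsmall : ∀ᶠ r : ℝ in 𝓝[>] 0, c * r < 1 ∧ c * r < k₀ := by
    have ht : Tendsto (fun r : ℝ => c * r) (𝓝[>] 0) (𝓝 0) := by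
      have : Tendsto (fun r : ℝ => c * r) (𝓝 0) (𝓝 (c * 0)) := tendsto_id.const_mul c
      rw [mul_zero] at this
      exact this.mono_left nhdsWithin_le_nhds
    exact (ht.eventually_lt_const one_pos).and (ht.eventually_lt_const hk₀pos)
  -- The summand `1` keeps the constant positive even when `c = 0`.
  refine ⟨2 * c / k₀ + d * c + 1, by positivity, ?_⟩
  filter_upwards [hsmall, Ioo_mem_nhdsGT hε₁, Ioo_mem_nhdsGT hε₂]
    with r ⟨hr1, hr2⟩ ⟨hr, hrε₁⟩ ⟨_, hrε₂⟩
  have hcr : 0 ≤ c * r := mul_nonneg hc hr.le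
  have hrV : Metric.ball p r ⊆ V := (Metric.ball_subset_ball hrε₂.le).trans hb₂
  set A := U ∩ φ ⁻¹' Metric.ball p r with hA
  have hAm : MeasurableSet A := h.isLocalParam.measurableSet_inter_preimage measurableSet_ball
  have hAB : A ⊆ Metric.ball 0 r := fun u hu => by
    have h1 := norm_graphCoord_le (ι := ι) (p := p) (φ u)
    rw [h.graphCoord_map u hu.1] at h1
    exact mem_ball_zero_iff.2 (h1.trans_lt (mem_ball_iff_norm.1 hu.2))
  have hBA : Metric.ball 0 ((1 - c * r) * r) ⊆ A := fun u hu => by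
    rw [mem_ball_zero_iff] at hu
    have hur : ‖u‖ < r := by nlinarith
    obtain ⟨⟨h3, -⟩, hU⟩ := hb₁ u (mem_ball_zero_iff.2 (hur.trans hrε₁))
    refine ⟨hU, mem_ball_iff_norm.2 (h3.trans_lt ?_)⟩
    have hle : 1 + c₁ * ‖u‖ ≤ 1 + c * r := by
      have : c₁ * ‖u‖ ≤ c * r := mul_le_mul (by linarith) hur.le (norm_nonneg _) hc
      linarith
    -- The inner radius works because `(1 - c r)(1 + c r) ≤ 1`.
    calc ‖u‖ * (1 + c₁ * ‖u‖) ≤ ‖u‖ * (1 + c * r) := by gcongr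
      _ < (1 - c * r) * r * (1 + c * r) := by gcongr
      _ ≤ r := by nlinarith [mul_nonneg (sq_nonneg (c * r)) hr.le]
  have hk : ∀ u ∈ A, |gramDensity φ u * g (φ u) - k₀| ≤ c * r := fun u hu => by
    have hur := mem_ball_zero_iff.1 (hAB hu)
    obtain ⟨⟨-, h4⟩, -⟩ := hb₁ u (mem_ball_zero_iff.2 (hur.trans hrε₁))
    exact h4.trans (mul_le_mul (by linarith) hur.le (norm_nonneg _) hc)
  have hkm : AEStronglyMeasurable (fun u => gramDensity φ u * g (φ u)) (volume.restrict A) := by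
    refine (measurable_gramDensity φ).aestronglyMeasurable.mul
      (hg.continuous.comp_aestronglyMeasurable ?_)
    exact (h.isLocalParam.continuousOn.mono Set.inter_subset_left).aestronglyMeasurable hAm
  rw [h.map_graphCoord_lawX hrV hg.continuous.measurable]
  obtain ⟨hprob, κ, hκ1, hκ2, hκ3⟩ :=
    exists_common_part_uniform hr hk₀pos hc hr1 hr2 hAm hAB hBA hk hkm
  refine ⟨(h.riemannianVolume_restrict_ball hrV).1, hprob, κ, hκ1, hκ2, hκ3.trans ?_⟩
  exact ENNReal.ofReal_le_ofReal (by nlinarith)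

theorem IsGraphChart.exists_linearIsometryEquiv (h : IsGraphChart M p ι U φ V) :
    ∃ e : EuclideanSpace ℝ (Fin d) ≃ₗᵢ[ℝ] embTangentSpace M p,
      ∀ x, tangentProj M p x = e (graphCoord ι p x) := by
  let e : EuclideanSpace ℝ (Fin d) ≃ₗᵢ[ℝ] embTangentSpace M p :=
    ι.equivRange.trans (LinearIsometryEquiv.ofEq _ _ h.embTangentSpace_eq.symm)
  have he : ∀ w, (e w : EuclideanSpace ℝ (Fin m)) = ι w := fun w => rfl
  refine ⟨e, fun x => ext_inner_right ℝ fun t => ?_⟩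
  obtain ⟨w, rfl⟩ := e.surjective t
  rw [e.inner_map_map, graphCoord, ContinuousLinearMap.adjoint_inner_left, tangentProj,
    Submodule.inner_orthogonalProjectionOnto_eq_of_mem_right, he]
  rfl

end Graph

theorem map_cond_ball {m d : ℕ} {T : Submodule ℝ (EuclideanSpace ℝ (Fin m))}
    (e : EuclideanSpace ℝ (Fin d) ≃ₗᵢ[ℝ] T) (r : ℝ) :
    (cond (volume : Measure (EuclideanSpace ℝ (Fin d))) (Metric.ball 0 r)).map e =
      uniformBall T r := by
  have hpre : e ⁻¹' Metric.ball 0 r = Metric.ball 0 r := by ext; simp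
  rw [uniformBall, ProbabilityTheory.cond, ProbabilityTheory.cond, Measure.map_smul, ← hpre,
    (e.measurePreserving.restrict_preimage measurableSet_ball).map_eq,
    e.measurePreserving.measure_preimage measurableSet_ball.nullMeasurableSet]

theorem mainTheorem8 {m d : ℕ} (hd : 1 ≤ d)
    (M : Set (EuclideanSpace ℝ (Fin m))) (hM : IsC2Submanifold d M)
    (p : EuclideanSpace ℝ (Fin m)) (hp : p ∈ M)
    {Ω : Type*} [MeasurableSpace Ω] (P : Measure Ω) [IsProbabilityMeasure P]
    (X : Ω → EuclideanSpace ℝ (Fin m)) (hX : AEMeasurable X P)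
    (g : EuclideanSpace ℝ (Fin m) → ℝ) (hg : HasDensityNear d M p P X g)
    (hLip : ∃ K : ℝ≥0, ∃ t ∈ 𝓝[M] p, LipschitzOnWith K g t) (hpos : 0 < g p) :
    ∃ C : ℝ, 0 < C ∧ ∀ᶠ r : ℝ in 𝓝[>] 0,
      ∃ γ : Measure (embTangentSpace M p × embTangentSpace M p),
        (IsCoupling γ (lawW d M p g r) (uniformBall (embTangentSpace M p) r) ∧
          γ {z | z.1 ≠ z.2} ≤ ENNReal.ofReal (C * r)) ∧
        (IsCoupling (γ.map (Prod.map unitVec unitVec))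
            ((lawW d M p g r).map unitVec) (uniformSphere (embTangentSpace M p)) ∧
          γ.map (Prod.map unitVec unitVec) {z | z.1 ≠ z.2} ≤ ENNReal.ofReal (C * r)) := by
  obtain ⟨ι, U, φ, V, h⟩ := exists_isGraphChart hM hp
  obtain ⟨e, he⟩ := h.exists_linearIsometryEquiv
  obtain ⟨K, t, ht, hK⟩ := hLip
  -- The law of `X(r)` sees only the values on `M ∩ B_r(p)`, so `g` may be replaced by a globally
  -- Lipschitz, hence measurable, extension.
  obtain ⟨g', hg', hgg'⟩ := hK.extend_real
  obtain ⟨ε, hε, hεt⟩ := Metric.mem_nhdsWithin_iff.1 ht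
  obtain ⟨C, hC, hev⟩ :=
    h.exists_common_part hg' (by rw [← hgg' (mem_of_mem_nhdsWithin hp ht)]; exact hpos)
  -- Here `1 ≤ d` enters: the tangent space must be nonzero for directions to be defined almost
  -- surely.
  have : Nonempty (Fin d) := ⟨⟨0, hd⟩⟩
  have : Nontrivial (embTangentSpace M p) := e.toEquiv.symm.nontrivial
  have hem : Measurable e := e.continuous.measurable
  have hproj : tangentProj M p = e ∘ graphCoord ι p := funext he
  refine ⟨C, hC, ?_⟩
  filter_upwards [hev, Ioo_mem_nhdsGT hε] with r ⟨hSm, hprob, κ, hκ1, hκ2, hκ3⟩ ⟨hr, hrε⟩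
  have hlaw : lawW d M p g r = ((lawX d M p g' r).map (graphCoord ι p)).map e := by
    rw [lawW, lawX_congr hSm fun x hx => hgg' (hεt ⟨Metric.ball_subset_ball hrε.le hx.2, hx.1⟩),
      hproj, Measure.map_map hem continuous_graphCoord.measurable]
  have hW : IsProbabilityMeasure (lawW d M p g r) := by
    rw [hlaw]; exact Measure.isProbabilityMeasure_map hem.aemeasurable
  have hD : IsProbabilityMeasure (uniformBall (embTangentSpace M p) r) :=
    cond_isProbabilityMeasure_of_finite (Metric.measure_ball_pos _ _ hr).ne'
      measure_ball_lt_top.ne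
  obtain ⟨γ, hγ, hγne⟩ := exists_isCoupling_of_le measurableSet_ne_prod
    (hlaw ▸ Measure.map_mono hκ1 hem) (map_cond_ball e r ▸ Measure.map_mono hκ2 hem)
  rw [Measure.map_apply hem .univ, Set.preimage_univ] at hγne
  refine ⟨γ, ⟨hγ, hγne.trans hκ3⟩, ?_,
    (map_prodMap_ne_le γ measurable_unitVec measurableSet_ne_prod).trans (hγne.trans hκ3)⟩
  rw [← map_unitVec_uniformBall hr]
  exact hγ.map measurable_unitVec
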